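/- Let $n\ge 1$, let $\mu=(\mu_1,\dots,\mu_k)$ be a partition of $n$ (with $\mu_i=0$ for $i>k$), and let $a=(a_1,\dots,a_h)$ be a composition of $n$ into positive parts. **Notation.** $\lambda(a)$ is the partition obtained by sorting the parts of $a$ in non-increasing order. For sequences of non-negative integers padded by zeros, $f\unrhd g$ (dominance) means $\sum_{i\le j}f_i\ge\sum_{i\le j}g_i$ for all $j\geq 1$, and $f\rhd g$ means $f\unrhd g$ and $f\ne g$. $\tilde a$ is $(a_1,\dots,a_{h-1},a_h-1)$ if $a_h\ge2$ and $(a_1,\dots,a_{h-1})$ if $a_h=1$; $\mu^{(i)}$ is obtained from $\mu$ by lowering $\mu_i$ by one. Let $$R(\mu,a)=\{i\ge 1:\mu_i>\mu_{i+1},\ \mu^{(i)}\unrhd\lambda(\tilde a)\},\qquad s(\mu,a)=\max\{i: 1\le i\le k,\ \mu_i\ge a_h\},$$ $$l(\mu,a,i)=\min\{p\in R(\mu,a):p\ge i\},\qquad l(\mu,a)=\min R(\mu,a).$$ $\mathrm{STab}(\mu,a)$ is the set of semistandard tableaux $T$ of shape $\mu$ and weight $a$ (entries in $\{1,\dots,h\}$,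 rows weakly increasing, columns strictly increasing, the entry $p$ occurring $a_p$ times). For $S,T\in\mathrm{STab}(\mu,a)$ and $1\le p\le h$ let $\sigma^{(p)},\tau^{(p)}$ be the sequences whose $i$-th terms are the numbers of entries $\le p$ in row $i$ of $S$, respectively of $T$. Put $S\le T$ if $S=T$, or if for some $1\le p\le h$ we have $\tau^{(q)}=\sigma^{(q)}$ for all $p<q\le h$ and $\tau^{(p)}\rhd\sigma^{(p)}$; this is a partial order. **Theorem 5.5.** Assume $\mu\unrhd\lambda(a)$. (1) Let $r\in R(\mu,a)$ with $r\le s(\mu,a)$. Put $a^0=a$, $l_0=r$, $\mu^0=\mu$, and for $0\le i<n$ put $a^{i+1}=\widetilde{a^i}$, $$l_{i+1}=\begin{cases}l(\mu^i,a^i,1)&\text{if } i\in\{a_h,\ a_h+a_{h-1},\ \dots,\ a_h+\cdots+a_2\},\\ l(\mu^i,a^i,l_i)&\text{otherwise,}\end{cases}\qquad \mu^{i+1}=(\mu^i)^{(l_{i+1})}.$$ Then the sets whose minima define $l_1,\dots,l_n$ are non-empty, and the boxes $(l_{i+1},\mu^i_{l_{i+1}})$, $0\le i<n$, are pairwise distinct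 and are exactly the boxes of the Young diagram of $\mu$. The filling $S$ of this diagram given by $S(l_{i+1},\mu^i_{l_{i+1}})=t$, where $\sum_{j=1}^{t-1}a_j<n-i\le\sum_{j=1}^{t}a_j$, belongs to $\mathrm{STab}(\mu,a)$ and is the least element of $$\{T\in\mathrm{STab}(\mu,a):\min\{i:T(i,\mu_i)=h\}\ge r\}.$$ (2) The number $r=l(\mu,a)$ exists and satisfies $r\in R(\mu,a)$ and $r\le s(\mu,a)$, and for this $r$ the tableau $S$ is the least element of $\mathrm{STab}(\mu,a)$. In particular $\mathrm{STab}(\mu,a)$ has a unique least element. -/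

import Mathlib

/-! Rows and columns of a Young diagram are numbered from `0`, as in Mathlib; the entries of a
tableau of weight `(a₁, …, a_h)` are `1, …, h`. A sequence of row lengths is a function `ℕ → ℕ`,
padded by zeros; for a Young diagram `μ` it is `μ.rowLen`. A composition `a` is given by the list
of its parts. -/

/-- The dominance order: every partial sum of `f` is at least the one of `g`. -/
def Dominates (f g : ℕ → ℕ) : Prop :=
  ∀ j : ℕ, ∑ i ∈ Finset.range j, g i ≤ ∑ i ∈ Finset.range j, f i

/-- `λ(a)`: the parts of `a` in non-increasing order, padded by zeros. -/
def sortedParts (a : List ℕ) : ℕ → ℕ :=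
  fun i => (a.insertionSort (· ≥ ·)).getD i 0

/-- The last part `a_h` of `a = (a₁, …, a_h)`. -/
def lastPart (a : List ℕ) : ℕ := a.getLastD 0

/-- `ã`: the last part of `a` is lowered by one, and dropped if it was `1`. -/
def lowerLast (a : List ℕ) : List ℕ :=
  if 2 ≤ lastPart a then a.dropLast ++ [lastPart a - 1] else a.dropLast

/-- `μ^{(i)}`: the last box of row `i` is removed. -/
def removeBox (μ : ℕ → ℕ) (i : ℕ) : ℕ → ℕ := Function.update μ i (μ i - 1)

/-- `R(μ, a)`: the rows whose last box is removable for the pair `(μ, a)`. -/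
def removableRows (μ : ℕ → ℕ) (a : List ℕ) : Set ℕ :=
  {i | μ (i + 1) < μ i ∧ Dominates (removeBox μ i) (sortedParts (lowerLast a))}

/-- `R(μ, a, i)`: the rows in `R(μ, a)` that are not above row `i`. -/
def removableRowsFrom (μ : ℕ → ℕ) (a : List ℕ) (i : ℕ) : Set ℕ :=
  {p | p ∈ removableRows μ a ∧ i ≤ p}

/-- `l(μ, a, i) = min R(μ, a, i)`. -/
noncomputable def minRowFrom (μ : ℕ → ℕ) (a : List ℕ) (i : ℕ) : ℕ :=
  sInf (removableRowsFrom μ a i)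

/-- `l(μ, a) = min R(μ, a)`. -/
noncomputable def minRow (μ : ℕ → ℕ) (a : List ℕ) : ℕ := sInf (removableRows μ a)

/-- `s(μ, a)`: the last (non-empty) row of length at least `a_h`. -/
noncomputable def maxRow (μ : ℕ → ℕ) (a : List ℕ) : ℕ :=
  sSup {i | 0 < μ i ∧ lastPart a ≤ μ i}

/-- `A = {a_h, a_h + a_{h-1}, …, a_h + ⋯ + a₂}`. -/
def tailSums (a : List ℕ) : Set ℕ :=
  {i | ∃ m : ℕ, 1 ≤ m ∧ m < a.length ∧ i = (a.drop m).sum}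

/-- The data `a^i`, `l_i`, `μ^i` of the box removal process after `i` steps. -/
structure RemovalState where
  weight : List ℕ
  row : ℕ
  shape : ℕ → ℕ

open Classical in
/-- The row from which on the row for step `i + 1` is searched: the first row if `i ∈ A`,
and the row `l_i` otherwise. -/
noncomputable def startRow (a : List ℕ) (i : ℕ) (s : RemovalState) : ℕ :=
  if i ∈ tailSums a then 0 else s.row

/-- The removal process: `a^0 = a`, `l_0 = r`, `μ^0 = μ`, and then `a^{i+1}` is `a^i` with its last
part lowered, `l_{i+1} = l(μ^i, a^i, 1)` (first row) if `i ∈ A` and `l(μ^i, a^i, l_i)` otherwise,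
and `μ^{i+1}` is `μ^i` without the last box of row `l_{i+1}`. -/
noncomputable def removal (μ : ℕ → ℕ) (a : List ℕ) (r : ℕ) : ℕ → RemovalState
  | 0 => ⟨a, r, μ⟩
  | i + 1 =>
    let s := removal μ a r i
    let l := minRowFrom s.shape s.weight (startRow a i s)
    ⟨lowerLast s.weight, l, removeBox s.shape l⟩

/-- The set `R(μ^i, a^i, 1)` or `R(μ^i, a^i, l_i)` whose minimum is `l_{i+1}`. -/
def candidateRows (μ : ℕ → ℕ) (a : List ℕ) (r i : ℕ) : Set ℕ :=
  removableRowsFrom (removal μ a r i).shape (removal μ a r i).weight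
    (startRow a i (removal μ a r i))

/-- The box removed in step `i + 1`: the last box of row `l_{i+1}` of `μ^i`. -/
noncomputable def removedBox (μ : ℕ → ℕ) (a : List ℕ) (r i : ℕ) : ℕ × ℕ :=
  ((removal μ a r (i + 1)).row,
    (removal μ a r i).shape (removal μ a r (i + 1)).row - 1)

/-- `STab(μ, a)`: the semistandard tableaux of shape `μ` and weight `a`. -/
def STab (μ : YoungDiagram) (a : List ℕ) : Type :=
  {T : SemistandardYoungTableau μ //
    (∀ c ∈ μ.cells, 1 ≤ T c.1 c.2 ∧ T c.1 c.2 ≤ a.length) ∧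
    ∀ p : Fin a.length, (μ.cells.filter fun c => T c.1 c.2 = (p : ℕ) + 1).card = a[p]}

namespace STab

variable {μ : YoungDiagram} {a : List ℕ}

/-- The entry `T(i, j)`. -/
def entry (T : STab μ a) (i j : ℕ) : ℕ := T.1 i j

/-- The sequence `τ^{(p)}`: the number of entries at most `p` in each row of `T`. -/
def rowCounts (T : STab μ a) (p : ℕ) : ℕ → ℕ :=
  fun i => ((Finset.range (μ.rowLen i)).filter fun j => T.entry i j ≤ p).card

/-- `min {i | T(i, μ_i) = h}`: the first row whose last entry is `h`. -/
noncomputable def firstMaxRow (T : STab μ a) : ℕ :=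
  sInf {i | 0 < μ.rowLen i ∧ T.entry i (μ.rowLen i - 1) = a.length}

end STab

theorem Dominates.trans {f g k : ℕ → ℕ} (h₁ : Dominates f g) (h₂ : Dominates g k) :
    Dominates f k := fun j => (h₂ j).trans (h₁ j)

theorem Dominates.antisymm {f g : ℕ → ℕ} (h₁ : Dominates f g) (h₂ : Dominates g f) :
    f = g := by
  funext i
  have e : ∀ j, ∑ i ∈ Finset.range j, f i = ∑ i ∈ Finset.range j, g i :=
    fun j => le_antisymm (h₂ j) (h₁ j)
  have h := e (i + 1)
  rw [Finset.sum_range_succ, Finset.sum_range_succ, e i] at h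
  omega

/-- `S ≤ T` if `S = T`, or, for the largest `p` with `τ^{(p)} ≠ σ^{(p)}`, the sequence `τ^{(p)}` of
`T` strictly dominates the sequence `σ^{(p)}` of `S`. -/
instance STab.instPartialOrder (μ : YoungDiagram) (a : List ℕ) : PartialOrder (STab μ a) where
  le S T := T = S ∨ ∃ p : ℕ, 1 ≤ p ∧ p ≤ a.length ∧
    (∀ q : ℕ, p < q → q ≤ a.length → T.rowCounts q = S.rowCounts q) ∧
    Dominates (T.rowCounts p) (S.rowCounts p) ∧ T.rowCounts p ≠ S.rowCounts p
  le_refl S := Or.inl rfl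
  le_trans S T U := by
    rintro (rfl | ⟨p, hp1, hph, hp, hd, hne⟩) (rfl | ⟨q, hq1, hqh, hq, hd', hne'⟩)
    · exact Or.inl rfl
    · exact Or.inr ⟨q, hq1, hqh, hq, hd', hne'⟩
    · exact Or.inr ⟨p, hp1, hph, hp, hd, hne⟩
    · right
      rcases lt_trichotomy p q with h | h | h
      · refine ⟨q, hq1, hqh, fun x hx hxh => ?_, ?_, ?_⟩
        · rw [hq x hx hxh, hp x (h.trans hx) hxh]
        · rw [← hp q h hqh]; exact hd'
        · rw [← hp q h hqh]; exact hne'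
      · subst h
        refine ⟨p, hp1, hph, fun x hx hxh => ?_, hd'.trans hd, fun e => ?_⟩
        · rw [hq x hx hxh, hp x hx hxh]
        · rw [e] at hd'
          exact hne (hd.antisymm hd')
      · refine ⟨p, hp1, hph, fun x hx hxh => ?_, ?_, ?_⟩
        · rw [hq x (h.trans hx) hxh, hp x hx hxh]
        · rw [hq p h hph]; exact hd
        · rw [hq p h hph]; exact hne
  le_antisymm S T := by
    rintro (rfl | ⟨p, hp1, hph, hp, hd, hne⟩) (h | ⟨q, hq1, hqh, hq, hd', hne'⟩)
    · rfl
    · rfl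
    · exact h
    · exfalso
      rcases lt_trichotomy p q with h | h | h
      · exact hne' (hp q h hqh).symm
      · subst h
        exact hne (hd.antisymm hd')
      · exact hne (hq p h hph).symm

/-- The defining property of the tableau `S`: the box removed in step `i + 1` carries the
entry `t` with `a₁ + ⋯ + a_{t-1} < n - i ≤ a₁ + ⋯ + a_t`, for `0 ≤ i < n`. -/
def IsRemovalTableau {μ : YoungDiagram} {a : List ℕ} (r : ℕ) (S : STab μ a) : Prop :=
  ∀ i < a.sum, ∀ t : ℕ, 1 ≤ t → t ≤ a.length →
    (a.take (t - 1)).sum < a.sum - i → a.sum - i ≤ (a.take t).sum →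
      S.entry (removedBox μ.rowLen a r i).1 (removedBox μ.rowLen a r i).2 = t

/-! A tableau of weight `a` is a chain of shapes from the empty one to `μ` in which level `q + 1`
adds a horizontal strip of `a[q]` boxes (`STab.isHorizontalStrip`, `STab.exists_rowCounts_eq`). The
order on tableaux is decided at the highest level where two chains differ, so a least tableau arises
by peeling strips from the top, each time leaving the shape that is lowest in dominance, that is,
taking boxes as high up as possible.

The one constraint is that the remaining shape still dominates the sorted remaining parts; every
tableau satisfies it (`STab.dominates_rowCounts`). Let `L j` be the sum of the `j` largest remaining
parts. A strip of `m` boxes in the rows from `r` on takes from the first `j` rows a number bounded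
by `m`, by the overhang of each row over the next, and by `psum f k - L k` for every `k ≥ j`. The
recursion `stripSum` meets these bounds as early as possible. The resulting greedy strip has full
size (`Peelable.le_stripSum_add`) and is optimal (`Peelable.dominates_stripShape`).

The box removal process is the greedy strip read from top to bottom (`isLeast_candidates`,
`removal_block`), so its shapes form the chain of the least tableau. -/

/-! ### Partial sums and dominance over sorted parts -/

/-- The sum of the first `j` terms of `f`. -/
def psum (f : ℕ → ℕ) (j : ℕ) : ℕ := ∑ i ∈ Finset.range j, f i

@[simp] theorem psum_zero (f : ℕ → ℕ) : psum f 0 = 0 := rfl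

theorem psum_succ (f : ℕ → ℕ) (j : ℕ) : psum f (j + 1) = psum f j + f j :=
  Finset.sum_range_succ f j

theorem dominates_iff {f g : ℕ → ℕ} : Dominates f g ↔ ∀ j, psum g j ≤ psum f j := Iff.rfl

theorem psum_mono (f : ℕ → ℕ) : Monotone (psum f) :=
  monotone_nat_of_le_succ fun j => by rw [psum_succ]; omega

theorem psum_getD (l : List ℕ) (j : ℕ) : psum (fun i => l.getD i 0) j = (l.take j).sum := by
  induction l generalizing j with
  | nil => simp [psum]
  | cons x l ih =>
    cases j with
    | zero => simp
    | succ j =>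
      rw [psum, Finset.sum_range_succ', List.take_succ_cons, List.sum_cons, ← ih, psum]
      simp [add_comm]

theorem psum_sortedParts (a : List ℕ) (j : ℕ) :
    psum (sortedParts a) j = ((a.insertionSort (· ≥ ·)).take j).sum :=
  psum_getD _ _

theorem sum_take_succ_le {l : List ℕ} {t : ℕ} (h : ∀ x ∈ l, x ≤ t) (j : ℕ) :
    (l.take (j + 1)).sum ≤ (l.take j).sum + t := by
  induction l generalizing j with
  | nil => simp
  | cons x l ih =>
    cases j with
    | zero => simpa using h x (by simp)
    | succ j =>
      have := ih (fun y hy => h y (by simp [hy])) j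
      simp only [List.take_succ_cons, List.sum_cons] at this ⊢
      omega

/-- The `j + 1` largest terms either avoid the new `t` or consist of `t` and the `j` largest old
ones. This lets dominance over `λ(a)` be tested without locating the last part in the sorted list.
-/
theorem sum_take_orderedInsert {l : List ℕ} (hl : l.Pairwise (· ≥ ·)) (t j : ℕ) :
    ((l.orderedInsert (· ≥ ·) t).take (j + 1)).sum =
      max (l.take (j + 1)).sum ((l.take j).sum + t) := by
  induction l generalizing j with
  | nil => simp
  | cons x l ih =>
    rw [List.pairwise_cons] at hl
    rw [List.orderedInsert_cons]
    split_ifs with h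
    · have h1 : ∀ y ∈ x :: l, y ≤ t := by
        intro y hy
        rcases List.mem_cons.1 hy with rfl | hy
        · exact h
        · exact (hl.1 y hy).trans h
      have := sum_take_succ_le h1 j
      rw [List.take_succ_cons, List.sum_cons]
      omega
    · cases j with
      | zero => simp; omega
      | succ j =>
        rw [List.take_succ_cons, List.sum_cons, ih hl.2, List.take_succ_cons, List.sum_cons,
          List.take_succ_cons, List.sum_cons]
        omega

theorem insertionSort_concat (a : List ℕ) (t : ℕ) :
    (a ++ [t]).insertionSort (· ≥ ·) =
      (a.insertionSort (· ≥ ·)).orderedInsert (· ≥ ·) t := by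
  refine List.Perm.eq_of_pairwise' (r := (· ≥ ·)) (List.pairwise_insertionSort _ _)
    ((List.pairwise_insertionSort _ _).orderedInsert _ _) ?_
  refine (List.perm_insertionSort _ _).trans ?_
  refine List.Perm.trans ?_ (List.perm_orderedInsert _ _ _).symm
  refine (List.perm_append_singleton t a).trans ?_
  exact List.Perm.cons _ (List.perm_insertionSort _ _).symm

theorem psum_sortedParts_concat (a : List ℕ) (t j : ℕ) :
    psum (sortedParts (a ++ [t])) (j + 1) =
      max (psum (sortedParts a) (j + 1)) (psum (sortedParts a) j + t) := by
  simp only [psum_sortedParts, insertionSort_concat]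
  exact sum_take_orderedInsert (List.pairwise_insertionSort _ _) t j

theorem dominates_sortedParts_concat {f : ℕ → ℕ} {a : List ℕ} {t : ℕ} :
    Dominates f (sortedParts (a ++ [t])) ↔ ∀ j, psum (sortedParts a) (j + 1) ≤ psum f (j + 1) ∧
      psum (sortedParts a) j + t ≤ psum f (j + 1) := by
  rw [dominates_iff]
  constructor
  · intro h j
    have := h (j + 1)
    rw [psum_sortedParts_concat] at this
    omega
  · rintro h (_ | j)
    · simp
    · rw [psum_sortedParts_concat]
      have := h j
      omega

theorem lowerLast_concat_of_two_le {a : List ℕ} {t : ℕ} (ht : 2 ≤ t) :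
    lowerLast (a ++ [t]) = a ++ [t - 1] := by
  simp [lowerLast, lastPart, ht]

theorem lowerLast_concat_one (a : List ℕ) : lowerLast (a ++ [1]) = a := by
  simp [lowerLast, lastPart]

theorem lastPart_concat (a : List ℕ) (t : ℕ) : lastPart (a ++ [t]) = t := by
  simp [lastPart]

/-- Covers both cases of `lowerLast`: for `t = 1` the second inequality follows from the first,
partial sums being monotone. -/
theorem dominates_lowerLast_concat {f : ℕ → ℕ} {a : List ℕ} {t : ℕ} (ht : 1 ≤ t) :
    Dominates f (sortedParts (lowerLast (a ++ [t]))) ↔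
      ∀ j, psum (sortedParts a) (j + 1) ≤ psum f (j + 1) ∧
        psum (sortedParts a) j + (t - 1) ≤ psum f (j + 1) := by
  rcases ht.eq_or_lt with rfl | h
  · rw [lowerLast_concat_one, dominates_iff]
    constructor
    · intro h j
      have h1 := psum_mono (sortedParts a) (Nat.le_succ j)
      have h2 := h (j + 1)
      simp only [Nat.succ_eq_add_one] at h1
      omega
    · rintro h (_ | j)
      · simp
      · exact (h j).1
  · rw [lowerLast_concat_of_two_le h, dominates_sortedParts_concat]

theorem psum_removeBox {g : ℕ → ℕ} {l : ℕ} (h : 0 < g l) (j : ℕ) :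
    psum (removeBox g l) j + (if l < j then 1 else 0) = psum g j := by
  induction j with
  | zero => simp
  | succ j ih =>
    rw [psum_succ, psum_succ, ← ih]
    by_cases hj : l = j
    · subst hj
      simp [removeBox]
      omega
    · have : removeBox g l j = g j := by
        simp [removeBox, Function.update_of_ne (Ne.symm hj)]
      rw [this]
      split_ifs <;> omega

/-! ### Horizontal strips -/

/-- `ν` arises from `μ` by removing a horizontal strip of `m` boxes. -/
def IsHorizontalStrip (μ ν : ℕ → ℕ) (m : ℕ) : Prop :=
  (∀ i, μ (i + 1) ≤ ν i ∧ ν i ≤ μ i) ∧ ∃ K, ∀ j, K ≤ j → psum μ j = psum ν j + m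

namespace IsHorizontalStrip

variable {μ ν : ℕ → ℕ} {m : ℕ}

/-- Descends from a `j` so large that all `m` boxes are counted; interlacing `μ (j + 1) ≤ ν j`
preserves the inequality on the way up the rows. -/
theorem psum_add_le (h : IsHorizontalStrip μ ν m) (j : ℕ) : psum ν j + m ≤ psum μ (j + 1) := by
  obtain ⟨h1, K, hK⟩ := h
  suffices ∀ d j, K ≤ j + d → psum ν j + m ≤ psum μ (j + 1) from this K j (by omega)
  intro d
  induction d with
  | zero =>
    intro j hj
    have h2 := hK j hj
    rw [psum_succ]; omega
  | succ d ih =>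
    intro j hj
    have h2 := ih (j + 1) (by omega)
    rw [psum_succ, psum_succ μ (j + 1)] at h2
    have := (h1 j).1
    omega

theorem psum_sub_mono (h : IsHorizontalStrip μ ν m) {j k : ℕ} (hjk : j ≤ k) :
    psum μ j + psum ν k ≤ psum μ k + psum ν j := by
  induction k, hjk using Nat.le_induction with
  | base => omega
  | succ k _ ih =>
    rw [psum_succ, psum_succ]
    have := (h.1 k).2
    omega

theorem psum_le (h : IsHorizontalStrip μ ν m) (j : ℕ) : psum μ j ≤ psum ν j + m := by
  obtain ⟨K, hK⟩ := h.2
  have h1 := h.psum_sub_mono (Nat.le_max_left j K)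
  have h2 := hK _ (Nat.le_max_right j K)
  omega

theorem dominates (h : IsHorizontalStrip μ ν m) {a : List ℕ} (hd : Dominates ν (sortedParts a)) :
    Dominates μ (sortedParts (a ++ [m])) := by
  rw [dominates_sortedParts_concat]
  intro j
  have h1 := hd (j + 1)
  have h2 := hd j
  have h3 := h.psum_add_le j
  have h4 := h.psum_sub_mono (Nat.zero_le (j + 1))
  simp only [psum_zero] at h4
  change psum _ _ ≤ psum _ _ at h1
  change psum _ _ ≤ psum _ _ at h2
  omega

end IsHorizontalStrip

/-! ### The greedy strip: existence and optimality -/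

/-- The largest number of boxes that can be removed from the first `j` rows of `f`, or from more
rows, so that the partial sums stay at least those of `L`. -/
noncomputable def stripBound (f L : ℕ → ℕ) (j : ℕ) : ℕ :=
  sInf ((fun k => psum f k - L k) '' Set.Ici j)

/-- The number of boxes in the first `j` rows of the horizontal strip with at most `m` boxes that is
obtained by removing greedily, from row `r` on, as many boxes as possible. -/
noncomputable def stripSum (f L : ℕ → ℕ) (m r : ℕ) : ℕ → ℕ
  | 0 => 0
  | j + 1 => if j < r then 0 else
      -- The three caps: row `j` keeps at least `f (j + 1)` boxes, the strip has at most `m` boxes,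
      -- and the partial sums from `j + 1` on stay at least those of `L`.
      min (stripSum f L m r j + (f j - f (j + 1))) (min m (stripBound f L (j + 1)))

/-- The shape that is left after removing the first `i` boxes of the greedy strip. -/
noncomputable def stripShape (f L : ℕ → ℕ) (m r i : ℕ) : ℕ → ℕ := fun l =>
  f l - (min (stripSum f L m r (l + 1)) i - min (stripSum f L m r l) i)

/-- The conditions under which a horizontal strip of size `m` can be removed from the rows
`≥ r` of `f`. -/
structure Peelable (f L : ℕ → ℕ) (m r : ℕ) : Prop where
  anti : Antitone f
  le : ∀ j, L j ≤ psum f j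
  le_succ : ∀ j, L j + m ≤ psum f (j + 1)
  row : m ≤ f r
  vanish : ∃ K, f K = 0

theorem exists_stripBound_eq (f L : ℕ → ℕ) (j : ℕ) :
    ∃ k, j ≤ k ∧ stripBound f L j = psum f k - L k := by
  have h := Nat.sInf_mem (s := (fun k => psum f k - L k) '' Set.Ici j)
    ⟨_, j, Set.mem_Ici.2 le_rfl, rfl⟩
  obtain ⟨k, hk, e⟩ := h
  exact ⟨k, hk, e.symm⟩

theorem stripBound_le (f L : ℕ → ℕ) {j k : ℕ} (h : j ≤ k) : stripBound f L j ≤ psum f k - L k :=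
  Nat.sInf_le ⟨k, h, rfl⟩

theorem stripBound_mono (f L : ℕ → ℕ) : Monotone (stripBound f L) := by
  intro i j hij
  obtain ⟨k, hk, e⟩ := exists_stripBound_eq f L j
  exact e ▸ stripBound_le f L (hij.trans hk)

section Greedy

variable {f L : ℕ → ℕ} {m r : ℕ}

theorem stripSum_succ_of_le {j : ℕ} (h : r ≤ j) : stripSum f L m r (j + 1) =
    min (stripSum f L m r j + (f j - f (j + 1))) (min m (stripBound f L (j + 1))) := by
  rw [stripSum, if_neg (by omega)]

theorem stripSum_eq_zero {j : ℕ} (h : j ≤ r) : stripSum f L m r j = 0 := by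
  cases j with
  | zero => rfl
  | succ j => rw [stripSum, if_pos (by omega)]

theorem stripSum_le_bound (j : ℕ) : stripSum f L m r j ≤ stripBound f L j := by
  cases j with
  | zero => simp [stripSum]
  | succ j =>
    rw [stripSum]
    split_ifs <;> omega

theorem stripSum_le (j : ℕ) : stripSum f L m r j ≤ m := by
  cases j with
  | zero => simp [stripSum]
  | succ j =>
    rw [stripSum]
    split_ifs <;> omega

theorem stripSum_mono : Monotone (stripSum f L m r) := by
  refine monotone_nat_of_le_succ fun j => ?_
  rcases lt_or_ge j r with h | h
  · rw [stripSum_eq_zero h.le]; omega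
  · rw [stripSum_succ_of_le h]
    have h1 := stripSum_le (f := f) (L := L) (m := m) (r := r) j
    have h2 := stripSum_le_bound (f := f) (L := L) (m := m) (r := r) j
    have h3 := stripBound_mono f L (Nat.le_succ j)
    simp only [Nat.succ_eq_add_one] at h3
    omega

theorem stripSum_succ_le (j : ℕ) :
    stripSum f L m r (j + 1) ≤ stripSum f L m r j + (f j - f (j + 1)) := by
  rw [stripSum]
  split_ifs <;> omega

theorem stripShape_zero : stripShape f L m r 0 = f := by
  funext l
  simp [stripShape]

namespace Peelable

variable (P : Peelable f L m r)
include P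

theorem stripSum_add_le {j k : ℕ} (h : j ≤ k) : stripSum f L m r j + L k ≤ psum f k := by
  have h1 := stripSum_le_bound (f := f) (L := L) (m := m) (r := r) j
  have h2 := stripBound_le f L h
  have h3 := P.le k
  omega

/-- The boxes still missing always fit into the next row, so the strip reaches size `m` once `f`
vanishes. If the dominance cap, attained at `k`, is active, `le_succ k` bounds the missing boxes by
`f k ≤ f (j + 1)`. -/
theorem le_stripSum_add {j : ℕ} (h : r ≤ j) : m ≤ stripSum f L m r j + f j := by
  induction j, h using Nat.le_induction with
  | base => exact P.row.trans (Nat.le_add_left _ _)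
  | succ j hj ih =>
    have h1 := P.anti (Nat.le_succ j)
    obtain ⟨k, hk, e⟩ := exists_stripBound_eq f L (j + 1)
    have h2 := P.le_succ k
    have h3 := P.anti hk
    rw [psum_succ] at h2
    rw [stripSum_succ_of_le hj]
    simp only [Nat.succ_eq_add_one] at h1
    omega

theorem exists_stripSum_eq : ∃ K, ∀ j, K ≤ j → stripSum f L m r j = m := by
  obtain ⟨K, hK⟩ := P.vanish
  refine ⟨max r K, fun j hj => ?_⟩
  have h1 := P.le_stripSum_add (j := j) (by omega)
  have h2 := P.anti (show K ≤ j by omega)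
  have h3 := stripSum_le (f := f) (L := L) (m := m) (r := r) j
  omega

theorem exists_row {i : ℕ} (hi : i < m) :
    ∃ l, r ≤ l ∧ stripSum f L m r l ≤ i ∧ i < stripSum f L m r (l + 1) := by
  obtain ⟨K, hK⟩ := P.exists_stripSum_eq
  have hex : ∃ l, i < stripSum f L m r (l + 1) := ⟨K, by rw [hK _ (Nat.le_succ K)]; exact hi⟩
  refine ⟨Nat.find hex, ?_, ?_, Nat.find_spec hex⟩
  · by_contra hlt
    have h1 := Nat.find_spec hex
    rw [stripSum_eq_zero (by omega)] at h1
    omega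
  · rcases hl : Nat.find hex with _ | l
    · simp [stripSum]
    · have := Nat.find_min hex (m := l) (by omega)
      omega

theorem stripShape_add (i l : ℕ) : stripShape f L m r i l + min (stripSum f L m r (l + 1)) i =
    f l + min (stripSum f L m r l) i := by
  have h1 := stripSum_succ_le (f := f) (L := L) (m := m) (r := r) l
  have h2 := stripSum_mono (f := f) (L := L) (m := m) (r := r) (Nat.le_succ l)
  have h3 := P.anti (Nat.le_succ l)
  simp only [Nat.succ_eq_add_one] at h2 h3
  rw [stripShape]
  omega

theorem psum_stripShape (i j : ℕ) :
    psum (stripShape f L m r i) j + min (stripSum f L m r j) i = psum f j := by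
  induction j with
  | zero => simp [stripSum]
  | succ j ih =>
    have := P.stripShape_add i j
    rw [psum_succ, psum_succ]
    omega

theorem isHorizontalStrip : IsHorizontalStrip f (stripShape f L m r m) m := by
  refine ⟨fun i => ?_, ?_⟩
  · have h1 := P.stripShape_add m i
    have h2 := stripSum_succ_le (f := f) (L := L) (m := m) (r := r) i
    have h3 := stripSum_mono (f := f) (L := L) (m := m) (r := r) (Nat.le_succ i)
    have h4 := P.anti (Nat.le_succ i)
    simp only [Nat.succ_eq_add_one] at h3 h4
    omega
  · obtain ⟨K, hK⟩ := P.exists_stripSum_eq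
    refine ⟨K, fun j hj => ?_⟩
    have h1 := P.psum_stripShape m j
    rw [hK j hj] at h1
    omega

theorem le_psum_stripShape (j : ℕ) : L j ≤ psum (stripShape f L m r m) j := by
  have h1 := P.psum_stripShape m j
  have h2 := P.stripSum_add_le (le_refl j)
  omega

theorem stripShape_eq_of_lt {i l : ℕ} (h : l < r) : stripShape f L m r i l = f l := by
  have h1 := P.stripShape_add i l
  rw [stripSum_eq_zero (by omega), stripSum_eq_zero (by omega)] at h1
  omega

/-- Every horizontal strip in the rows `≥ r` leaves a shape that dominates the one that is left
by the greedy strip. -/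
theorem dominates_stripShape {ν : ℕ → ℕ} (hν : IsHorizontalStrip f ν m)
    (hL : ∀ j, L j ≤ psum ν j) (hr : ∀ i < r, ν i = f i) :
    Dominates ν (stripShape f L m r m) := by
  -- Equivalently, no competing strip takes more than `stripSum` boxes from the first `j` rows; by
  -- induction it obeys each of the three caps.
  suffices h : ∀ j, psum f j ≤ psum ν j + stripSum f L m r j by
    intro j
    have h1 := P.psum_stripShape m j
    have h2 := h j
    have h3 := stripSum_le (f := f) (L := L) (m := m) (r := r) j
    change psum _ _ ≤ psum _ _
    omega
  intro j
  induction j with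
  | zero => simp
  | succ j ih =>
    rcases lt_or_ge j r with h | h
    · rw [stripSum_eq_zero h.le] at ih
      rw [psum_succ, psum_succ, hr j h]
      omega
    · obtain ⟨k, hk, e⟩ := exists_stripBound_eq f L (j + 1)
      have h1 := hν.psum_sub_mono hk
      have h2 := hL k
      have h3 := hν.psum_le (j + 1)
      have h4 := (hν.1 j).1
      have h5 := P.le k
      rw [stripSum_succ_of_le h, e]
      have h6 : psum f (j + 1) ≤
          psum ν (j + 1) + (stripSum f L m r j + (f j - f (j + 1))) := by
        rw [psum_succ, psum_succ]; omega
      omega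

end Peelable

end Greedy

/-! ### One removal step within a part -/

section Block

variable {f : ℕ → ℕ} {b : List ℕ} {m r : ℕ}

theorem Peelable.of_dominates (hanti : Antitone f) (hv : ∃ K, f K = 0)
    (hd : Dominates f (sortedParts (b ++ [m]))) (hr : m ≤ f r) :
    Peelable f (psum (sortedParts b)) m r where
  anti := hanti
  le := by
    rintro (_ | j)
    · simp
    · exact (dominates_sortedParts_concat.1 hd j).1
  le_succ j := (dominates_sortedParts_concat.1 hd j).2
  row := hr
  vanish := hv

/-- The next row of the process is the row of box `i` of the greedy strip, counting from `0`. The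
search may start from any `ρ ≥ r` with `stripSum` at most `i` at `ρ` and at least `i` at `ρ + 1`;
this covers both the initial row and the row just used. -/
theorem isLeast_candidates (P : Peelable f (psum (sortedParts b)) m r) {i ρ l : ℕ} (hi : i < m)
    (hρ : r ≤ ρ) (hρ1 : stripSum f (psum (sortedParts b)) m r ρ ≤ i)
    (hρ2 : i ≤ stripSum f (psum (sortedParts b)) m r (ρ + 1))
    (hl1 : stripSum f (psum (sortedParts b)) m r l ≤ i)
    (hl2 : i < stripSum f (psum (sortedParts b)) m r (l + 1)) :
    IsLeast (removableRowsFrom (stripShape f (psum (sortedParts b)) m r i)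
      (b ++ [m - i]) ρ) l := by
  set L := psum (sortedParts b) with hL
  set D := stripSum f L m r with hD
  set g := stripShape f L m r i with hg
  have hmono : Monotone D := stripSum_mono
  have hps : ∀ j, psum g j + min (D j) i = psum f j := P.psum_stripShape i
  have hsa : ∀ j, g j + min (D (j + 1)) i = f j + min (D j) i := P.stripShape_add i
  constructor
  · have hgl : g (l + 1) < g l := by
      have h1 := hsa l
      have h2 := hsa (l + 1)
      have h3 : D (l + 1) ≤ D l + (f l - f (l + 1)) := stripSum_succ_le l
      have h4 := hmono (Nat.le_succ (l + 1))
      simp only [Nat.succ_eq_add_one] at h4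
      omega
    refine ⟨⟨hgl, (dominates_lowerLast_concat (by omega)).2 fun j => ?_⟩, ?_⟩
    · have h1 := psum_removeBox (g := g) (l := l) (by omega) (j + 1)
      have h2 := hps (j + 1)
      have h3 := P.le_succ j
      have h4 : D (j + 1) + L (j + 1) ≤ psum f (j + 1) := P.stripSum_add_le le_rfl
      rw [← hL]
      split_ifs at h1 with hlj
      · have h5 := hmono (show l + 1 ≤ j + 1 by omega)
        omega
      · omega
    · by_contra hlt
      have := hmono (show l + 1 ≤ ρ by omega)
      omega
  · rintro p ⟨⟨hp1, hp2⟩, hp3⟩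
    by_contra! hlt
    rw [dominates_lowerLast_concat (by omega), ← hL] at hp2
    have h1 := hmono (show p + 1 ≤ l by omega)
    have h2 := hmono (show ρ + 1 ≤ p + 1 by omega)
    have h3 : D (p + 1) = min (D p + (f p - f (p + 1))) (min m (stripBound f L (p + 1))) :=
      stripSum_succ_of_le (by omega)
    have h0 := hmono (Nat.le_succ p)
    simp only [Nat.succ_eq_add_one] at h0
    -- Here `D (p + 1) = i < m`, so another cap is active in row `p`: either the row is already as
    -- short as the next one, or dominance is tight at some `k > p` and one more box would break it.
    rcases (show D p + (f p - f (p + 1)) = i ∨ stripBound f L (p + 1) = i by omega) with h | h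
    · have h4 := hsa p
      have h5 := hsa (p + 1)
      have h6 := hmono (Nat.le_succ (p + 1))
      have h7 := P.anti (Nat.le_succ p)
      simp only [Nat.succ_eq_add_one] at h6 h7
      omega
    · obtain ⟨k, hk, e⟩ := exists_stripBound_eq f L (p + 1)
      obtain ⟨k, rfl⟩ : ∃ k', k = k' + 1 := ⟨k - 1, by omega⟩
      have h4 := (hp2 k).1
      have h5 := psum_removeBox (g := g) (l := p) (by omega) (k + 1)
      rw [if_pos (by omega)] at h5
      have h6 := hps (k + 1)
      have h7 := hmono hk
      omega

theorem removeBox_stripShape {L : ℕ → ℕ} (P : Peelable f L m r) {i l : ℕ}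
    (hl1 : stripSum f L m r l ≤ i) (hl2 : i < stripSum f L m r (l + 1)) :
    removeBox (stripShape f L m r i) l = stripShape f L m r (i + 1) := by
  funext j
  have h1 := P.stripShape_add i j
  have h2 := P.stripShape_add (i + 1) j
  rcases lt_trichotomy j l with h | rfl | h
  · have h3 := stripSum_mono (f := f) (L := L) (m := m) (r := r) (show j + 1 ≤ l by omega)
    have h4 := stripSum_mono (f := f) (L := L) (m := m) (r := r) (show j ≤ l by omega)
    rw [removeBox, Function.update_of_ne h.ne]
    omega
  · rw [removeBox, Function.update_self]
    omega
  · have h3 := stripSum_mono (f := f) (L := L) (m := m) (r := r) (show l + 1 ≤ j by omega)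
    have h4 := stripSum_mono (f := f) (L := L) (m := m) (r := r) (show l + 1 ≤ j + 1 by omega)
    rw [removeBox, Function.update_of_ne h.ne']
    omega

end Block

theorem minRowFrom_eq {f : ℕ → ℕ} {a : List ℕ} {ρ l : ℕ}
    (h : IsLeast (removableRowsFrom f a ρ) l) : minRowFrom f a ρ = l :=
  h.csInf_eq

/-! ### The removal process -/

section Removal

variable {μ : ℕ → ℕ} {a : List ℕ} {r : ℕ}

theorem sum_drop_eq {q : ℕ} (hq : q < a.length) :
    (a.drop q).sum = (a.drop (q + 1)).sum + a[q] := by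
  rw [List.drop_eq_getElem_cons hq, List.sum_cons, add_comm]

theorem sum_drop_antitone (a : List ℕ) : Antitone fun q => (a.drop q).sum := by
  refine antitone_nat_of_succ_le fun q => ?_
  rcases lt_or_ge q a.length with h | h
  · exact (sum_drop_eq h).symm ▸ Nat.le_add_right _ _
  · simp [List.drop_eq_nil_of_le h, List.drop_eq_nil_of_le (h.trans (Nat.le_succ q))]

theorem not_mem_tailSums {q i : ℕ} (h1 : (a.drop (q + 1)).sum < i)
    (h2 : i < (a.drop q).sum) : i ∉ tailSums a := by
  rintro ⟨m, -, -, rfl⟩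
  rcases Nat.lt_or_ge q m with h | h
  · have := sum_drop_antitone a (show q + 1 ≤ m by omega)
    simp only at this
    omega
  · have := sum_drop_antitone a h
    simp only at this
    omega

/-- The weight that is left after `i` steps of removing the last part `m` of `b ++ [m]`. -/
def partialWeight (b : List ℕ) (m i : ℕ) : List ℕ := if i < m then b ++ [m - i] else b

theorem lowerLast_partialWeight {b : List ℕ} {m i : ℕ} (h : i < m) :
    lowerLast (partialWeight b m i) = partialWeight b m (i + 1) := by
  rw [partialWeight, if_pos h, partialWeight]
  split_ifs with h'
  · rw [lowerLast_concat_of_two_le (by omega), Nat.sub_sub]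
  · rw [show m - i = 1 by omega, lowerLast_concat_one]

/-- The process while it works on the part `a[q]`. -/
theorem removal_block {q ρ : ℕ} (hq : q < a.length) (hpos : 0 < a[q])
    (hstart : startRow a (a.drop (q + 1)).sum (removal μ a r (a.drop (q + 1)).sum) = ρ)
    (hw : (removal μ a r (a.drop (q + 1)).sum).weight = a.take (q + 1))
    (P : Peelable (removal μ a r (a.drop (q + 1)).sum).shape (psum (sortedParts (a.take q)))
      a[q] ρ) {i : ℕ} (hi : i ≤ a[q]) :
    let t := (a.drop (q + 1)).sum
    let f := (removal μ a r t).shape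
    let L := psum (sortedParts (a.take q))
    (removal μ a r (t + i)).shape = stripShape f L a[q] ρ i ∧
    (removal μ a r (t + i)).weight = partialWeight (a.take q) a[q] i ∧
    (i < a[q] → ρ ≤ startRow a (t + i) (removal μ a r (t + i)) ∧
      stripSum f L a[q] ρ (startRow a (t + i) (removal μ a r (t + i))) ≤ i ∧
      i ≤ stripSum f L a[q] ρ (startRow a (t + i) (removal μ a r (t + i)) + 1) ∧
      (candidateRows μ a r (t + i)).Nonempty) := by
  intro t f L
  have key : ∀ i < a[q], (removal μ a r (t + i)).shape = stripShape f L a[q] ρ i →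
      (removal μ a r (t + i)).weight = partialWeight (a.take q) a[q] i →
      ρ ≤ startRow a (t + i) (removal μ a r (t + i)) →
      stripSum f L a[q] ρ (startRow a (t + i) (removal μ a r (t + i))) ≤ i →
      i ≤ stripSum f L a[q] ρ (startRow a (t + i) (removal μ a r (t + i)) + 1) →
      ∃ l, ρ ≤ l ∧ stripSum f L a[q] ρ l ≤ i ∧ i < stripSum f L a[q] ρ (l + 1) ∧
        IsLeast (candidateRows μ a r (t + i)) l := by
    intro i hi h1 h2 h3 h4 h5
    obtain ⟨l, hl0, hl1, hl2⟩ := P.exists_row hi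
    refine ⟨l, hl0, hl1, hl2, ?_⟩
    rw [candidateRows, h1, h2, partialWeight, if_pos hi]
    exact isLeast_candidates P hi h3 h4 h5 hl1 hl2
  induction i with
  | zero =>
    have hs : (removal μ a r (t + 0)).shape = stripShape f L a[q] ρ 0 := stripShape_zero.symm
    have hw' : (removal μ a r (t + 0)).weight = partialWeight (a.take q) a[q] 0 := by
      rw [partialWeight, if_pos hpos]
      simpa [List.take_concat_get'] using hw
    refine ⟨hs, hw', fun h0 => ?_⟩
    have e : startRow a (t + 0) (removal μ a r (t + 0)) = ρ := hstart
    have e' : stripSum f L a[q] ρ ρ ≤ 0 := (stripSum_eq_zero le_rfl).le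
    obtain ⟨l, -, -, -, hl⟩ := key 0 h0 hs hw' e.ge (by rw [e]; exact e') (Nat.zero_le _)
    exact ⟨e.ge, by rw [e]; exact e', Nat.zero_le _, l, hl.1⟩
  | succ i ih =>
    obtain ⟨h1, h2, h3⟩ := ih (by omega)
    obtain ⟨h3, h4, h5, -⟩ := h3 (by omega)
    obtain ⟨l, hl0, hl1, hl2, hl⟩ := key i (by omega) h1 h2 h3 h4 h5
    have hmin : minRowFrom (removal μ a r (t + i)).shape (removal μ a r (t + i)).weight
        (startRow a (t + i) (removal μ a r (t + i))) = l := minRowFrom_eq hl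
    have hrow : (removal μ a r (t + (i + 1))).row = l := hmin
    have hs : (removal μ a r (t + (i + 1))).shape = stripShape f L a[q] ρ (i + 1) := by
      rw [← removeBox_stripShape P hl1 hl2, ← h1, ← hmin]
      rfl
    have hw' : (removal μ a r (t + (i + 1))).weight =
        partialWeight (a.take q) a[q] (i + 1) := by
      rw [← lowerLast_partialWeight (by omega), ← h2]
      rfl
    refine ⟨hs, hw', fun hlt => ?_⟩
    have e : startRow a (t + (i + 1)) (removal μ a r (t + (i + 1))) = l := by
      -- Strictly between two consecutive tail sums the search is not reset, so it resumes in row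
      -- `l`.
      rw [startRow, if_neg, hrow]
      refine not_mem_tailSums (q := q) ?_ ?_
      · change t < _; omega
      · rw [sum_drop_eq hq]; change _ < t + _; omega
    obtain ⟨l', -, -, -, hl'⟩ := key (i + 1) hlt hs hw' (by rw [e]; exact hl0)
      (by rw [e]; omega) (by rw [e]; omega)
    rw [e]
    exact ⟨hl0, by omega, by omega, l', hl'.1⟩

theorem removal_shape_succ_le (i j : ℕ) :
    (removal μ a r (i + 1)).shape j ≤ (removal μ a r i).shape j := by
  change removeBox (removal μ a r i).shape _ j ≤ _
  rw [removeBox, Function.update_apply]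
  split_ifs with h
  · rw [h]; omega
  · rfl

theorem removal_shape_antitone {i k : ℕ} (h : i ≤ k) (j : ℕ) :
    (removal μ a r k).shape j ≤ (removal μ a r i).shape j := by
  induction k, h using Nat.le_induction with
  | base => rfl
  | succ k _ ih => exact (removal_shape_succ_le k j).trans ih

theorem removedBox_lt {i : ℕ} (h : (candidateRows μ a r i).Nonempty) :
    (removedBox μ a r i).2 < (removal μ a r i).shape (removedBox μ a r i).1 := by
  have h1 := (Nat.sInf_mem h).1.1
  change (removal μ a r i).shape (minRowFrom _ _ _) - 1 <
    (removal μ a r i).shape (minRowFrom _ _ _)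
  unfold minRowFrom
  unfold candidateRows at h1
  omega

theorem shape_succ_le_removedBox (i : ℕ) :
    (removal μ a r (i + 1)).shape (removedBox μ a r i).1 ≤ (removedBox μ a r i).2 := by
  change removeBox _ _ _ ≤ _
  rw [removeBox]
  exact (Function.update_self _ _ _).le

/-- A removed box lies outside all later shapes, while the box of step `k` lies in the shape before
it. Hence the boxes are distinct, and counting gives surjectivity. -/
theorem bijOn_removedBox {μ : YoungDiagram} {n : ℕ} (hμ : μ.card = n)
    (h : ∀ i < n, (candidateRows μ.rowLen a r i).Nonempty) :
    Set.BijOn (removedBox μ.rowLen a r) (Set.Iio n) (μ.cells : Set (ℕ × ℕ)) := by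
  have hmaps : ∀ i < n, removedBox μ.rowLen a r i ∈ μ.cells := by
    intro i hi
    rw [YoungDiagram.mem_cells, ← Prod.mk.eta (p := removedBox μ.rowLen a r i),
      YoungDiagram.mem_iff_lt_rowLen]
    exact (removedBox_lt (h i hi)).trans_le (removal_shape_antitone (Nat.zero_le i) _)
  have hne : ∀ i k, i < k → k < n → removedBox μ.rowLen a r i ≠ removedBox μ.rowLen a r k := by
    intro i k hik hk e
    have h1 := removedBox_lt (h k hk)
    have h2 := shape_succ_le_removedBox (μ := μ.rowLen) (a := a) (r := r) i
    have h3 := removal_shape_antitone (μ := μ.rowLen) (a := a) (r := r) (show i + 1 ≤ k from hik)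
      (removedBox μ.rowLen a r k).1
    rw [e] at h2
    omega
  have hinj : Set.InjOn (removedBox μ.rowLen a r) (Finset.range n : Set ℕ) := by
    intro i hi k hk e
    rw [Finset.coe_range] at hi hk
    rcases lt_trichotomy i k with hlt | rfl | hlt
    · exact absurd e (hne i k hlt hk)
    · rfl
    · exact absurd e.symm (hne k i hlt hi)
  have hsurj := Finset.surjOn_of_injOn_of_card_le (s := Finset.range n) (t := μ.cells)
    (removedBox μ.rowLen a r) (fun i hi => hmaps i (by simpa using hi)) hinj
    (by rw [Finset.card_range]; exact hμ.le)
  rw [Finset.coe_range] at hinj hsurj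
  exact ⟨fun i hi => hmaps i hi, hinj, hsurj⟩

end Removal

/-! ### Tableaux as chains of horizontal strips -/

theorem lt_card_filter_range_iff {p : ℕ → Prop} [DecidablePred p] {n j : ℕ} (hj : j < n)
    (hp : ∀ i k, i < k → k < n → p k → p i) :
    j < ((Finset.range n).filter p).card ↔ p j := by
  constructor
  · intro h
    by_contra hpj
    have hsub : (Finset.range n).filter p ⊆ Finset.range j := by
      intro k hk
      rw [Finset.mem_filter, Finset.mem_range] at hk
      rw [Finset.mem_range]
      by_contra hjk
      rcases (not_lt.1 hjk).eq_or_lt with rfl | hlt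
      · exact hpj hk.2
      · exact hpj (hp j k hlt hk.1 hk.2)
    have := Finset.card_le_card hsub
    rw [Finset.card_range] at this
    omega
  · intro h
    have hsub : Finset.range (j + 1) ⊆ (Finset.range n).filter p := by
      intro k hk
      rw [Finset.mem_range] at hk
      rw [Finset.mem_filter, Finset.mem_range]
      refine ⟨by omega, ?_⟩
      rcases (Nat.lt_succ_iff.1 hk).eq_or_lt with rfl | hlt
      · exact h
      · exact hp k j hlt hj h
    have := Finset.card_le_card hsub
    rw [Finset.card_range] at this
    omega

theorem YoungDiagram.rowLen_eq_zero {μ : YoungDiagram} {i : ℕ} (h : μ.colLen 0 ≤ i) :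
    μ.rowLen i = 0 := by
  by_contra h0
  have h1 := YoungDiagram.mem_iff_lt_rowLen.2 (Nat.pos_of_ne_zero h0)
  have h2 := YoungDiagram.mem_iff_lt_colLen.1 h1
  omega

theorem card_filter_le_eq_psum (μ : YoungDiagram) (F : ℕ → ℕ → ℕ) (q : ℕ) {K : ℕ}
    (hK : μ.colLen 0 ≤ K) :
    (μ.cells.filter fun c => F c.1 c.2 ≤ q).card =
      psum (fun i => ((Finset.range (μ.rowLen i)).filter fun j => F i j ≤ q).card) K := by
  rw [psum, Finset.card_eq_sum_card_fiberwise (f := Prod.fst) (t := Finset.range K)]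
  · refine Finset.sum_congr rfl fun i _ => ?_
    refine Finset.card_bij' (fun c _ => c.2) (fun j _ => (i, j)) ?_ ?_ ?_ ?_
    · rintro ⟨x, j⟩ hc
      simp only [Finset.mem_filter, YoungDiagram.mem_cells, YoungDiagram.mem_iff_lt_rowLen] at hc
      obtain ⟨⟨h1, h2⟩, rfl⟩ := hc
      simp [h1, h2]
    · intro j hj
      simp only [Finset.mem_filter, Finset.mem_range] at hj
      simp [YoungDiagram.mem_iff_lt_rowLen, hj]
    · rintro ⟨x, j⟩ hc
      simp only [Finset.mem_filter] at hc
      simp [hc.2]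
    · intro j _
      rfl
  · rintro ⟨x, j⟩ hc
    simp only [Finset.coe_filter, Set.mem_ofPred_eq, YoungDiagram.mem_cells,
      YoungDiagram.mem_iff_lt_rowLen] at hc
    simp only [Finset.coe_range, Set.mem_Iio]
    by_contra hx
    have := YoungDiagram.rowLen_eq_zero (μ := μ) (i := x) (by omega)
    omega

theorem card_filter_eq_add (μ : YoungDiagram) (F : ℕ → ℕ → ℕ) (q : ℕ) :
    (μ.cells.filter fun c => F c.1 c.2 ≤ q + 1).card =
      (μ.cells.filter fun c => F c.1 c.2 ≤ q).card +
        (μ.cells.filter fun c => F c.1 c.2 = q + 1).card := by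
  rw [← Finset.card_union_of_disjoint, ← Finset.filter_or]
  · congr 1
    refine Finset.filter_congr fun c _ => ?_
    omega
  · refine Finset.disjoint_filter.2 fun c _ h1 h2 => ?_
    omega

namespace STab

variable {μ : YoungDiagram} {a : List ℕ}

/-- Rows increase weakly, so the entries at most `q` fill an initial segment; a tableau is thereby
encoded by its row counts. -/
theorem entry_le_iff (T : STab μ a) {i j : ℕ} (hj : j < μ.rowLen i) (q : ℕ) :
    T.entry i j ≤ q ↔ j < T.rowCounts q i := by
  refine (lt_card_filter_range_iff (p := fun j => T.entry i j ≤ q) hj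
    fun k l hkl hl h => ?_).symm
  exact (T.1.row_weak hkl (YoungDiagram.mem_iff_lt_rowLen.2 hl)).trans h

theorem rowCounts_le_rowLen (T : STab μ a) (q i : ℕ) : T.rowCounts q i ≤ μ.rowLen i :=
  (Finset.card_filter_le _ _).trans (Finset.card_range _).le

theorem rowCounts_mono (T : STab μ a) {p q : ℕ} (h : p ≤ q) (i : ℕ) :
    T.rowCounts p i ≤ T.rowCounts q i :=
  Finset.card_le_card fun j hj => by
    rw [Finset.mem_filter] at hj ⊢
    exact ⟨hj.1, hj.2.trans h⟩

theorem entry_bounds (T : STab μ a) {i j : ℕ} (hj : j < μ.rowLen i) :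
    1 ≤ T.entry i j ∧ T.entry i j ≤ a.length :=
  T.2.1 (i, j) ((YoungDiagram.mem_cells _).2 (YoungDiagram.mem_iff_lt_rowLen.2 hj))

theorem rowCounts_length (T : STab μ a) : T.rowCounts a.length = μ.rowLen := by
  funext i
  refine le_antisymm (T.rowCounts_le_rowLen _ _) (le_of_forall_lt fun j hj => ?_)
  exact (T.entry_le_iff hj _).1 (T.entry_bounds hj).2

/-- Column strictness gives interlacing: the box above an entry at most `q + 1` carries an entry at
most `q`. -/
theorem isHorizontalStrip (T : STab μ a) {q : ℕ} (hq : q < a.length) :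
    IsHorizontalStrip (T.rowCounts (q + 1)) (T.rowCounts q) a[q] := by
  refine ⟨fun i => ⟨le_of_forall_lt fun j hj => ?_, T.rowCounts_mono (Nat.le_succ q) i⟩,
    μ.colLen 0, fun K hK => ?_⟩
  · have h1 := hj.trans_le (T.rowCounts_le_rowLen _ _)
    have h2 := (T.entry_le_iff h1 _).2 hj
    have h3 := T.1.col_strict (Nat.lt_succ_self i) (YoungDiagram.mem_iff_lt_rowLen.2 h1)
    refine (T.entry_le_iff (h1.trans_le (μ.rowLen_anti _ _ (Nat.le_succ i))) _).1 ?_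
    change T.1 i j ≤ q
    change T.1 (i + 1) j ≤ q + 1 at h2
    simp only [Nat.succ_eq_add_one] at h3
    omega
  · have h1 := card_filter_le_eq_psum μ (fun i j => T.entry i j) q hK
    have h2 := card_filter_le_eq_psum μ (fun i j => T.entry i j) (q + 1) hK
    have h3 := card_filter_eq_add μ (fun i j => T.entry i j) q
    have h4 : (μ.cells.filter fun c => T.entry c.1 c.2 = q + 1).card = a[q] := T.2.2 ⟨q, hq⟩
    rw [h1, h2, h4] at h3
    exact h3

theorem dominates_rowCounts (T : STab μ a) {q : ℕ} (hq : q ≤ a.length) :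
    Dominates (T.rowCounts q) (sortedParts (a.take q)) := by
  induction q with
  | zero =>
    intro j
    simp [sortedParts]
  | succ q ih =>
    rw [List.take_succ_eq_append_getElem hq]
    exact (T.isHorizontalStrip hq).dominates (ih (by omega))

theorem ext_rowCounts {S T : STab μ a}
    (h : ∀ q, 1 ≤ q → q ≤ a.length → S.rowCounts q = T.rowCounts q) : S = T := by
  refine Subtype.ext (DFunLike.ext' (funext fun i => funext fun j => ?_))
  change S.entry i j = T.entry i j
  by_cases hj : j < μ.rowLen i
  · obtain ⟨h1, h2⟩ := S.entry_bounds hj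
    obtain ⟨h3, h4⟩ := T.entry_bounds hj
    refine le_antisymm ?_ ?_
    · rw [S.entry_le_iff hj, h _ h3 h4, ← T.entry_le_iff hj]
    · rw [T.entry_le_iff hj, ← h _ h1 h2, ← S.entry_le_iff hj]
  · have hn : (i, j) ∉ μ := fun hc => hj (YoungDiagram.mem_iff_lt_rowLen.1 hc)
    exact (S.1.zeros hn).trans (T.1.zeros hn).symm

/-- A chain of horizontal strips is the chain of row counts of a tableau. -/
theorem exists_rowCounts_eq {κ : ℕ → ℕ → ℕ} (h0 : κ 0 = fun _ => 0)
    (hlen : κ a.length = μ.rowLen)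
    (hs : ∀ q (hq : q < a.length), IsHorizontalStrip (κ (q + 1)) (κ q) a[q]) :
    ∃ S : STab μ a, ∀ q ≤ a.length, S.rowCounts q = κ q := by
  have hmono : ∀ p q, p ≤ q → q ≤ a.length → ∀ i, κ p i ≤ κ q i := by
    intro p q hpq
    induction q, hpq using Nat.le_induction with
    | base => exact fun _ _ => le_rfl
    | succ q _ ih => exact fun hq i => (ih (by omega) i).trans ((hs q hq).1 i).2
  have hanti : ∀ q ≤ a.length, Antitone (κ q) := by
    rintro (_ | q) hq
    · rw [h0]; exact antitone_const
    · exact antitone_nat_of_succ_le fun i => ((hs q hq).1 i).1.trans ((hs q hq).1 i).2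
  have hle : ∀ q ≤ a.length, ∀ i, κ q i ≤ μ.rowLen i := fun q hq i =>
    hlen ▸ hmono q a.length hq le_rfl i
  -- The entry of a box is the first level whose shape contains it.
  let e : ℕ → ℕ → ℕ := fun i j => sInf {q | j < κ q i}
  have he : ∀ i j, j < μ.rowLen i → j < κ (e i j) i ∧ 1 ≤ e i j ∧ e i j ≤ a.length := by
    intro i j hj
    have hm : a.length ∈ {q | j < κ q i} := by
      rw [Set.mem_ofPred_eq, hlen]; exact hj
    have h1 : j < κ (e i j) i := Nat.sInf_mem ⟨_, hm⟩
    refine ⟨h1, ?_, Nat.sInf_le hm⟩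
    by_contra h
    rw [show e i j = 0 by omega, h0] at h1
    exact Nat.not_lt_zero _ h1
  have hiff : ∀ i j, j < μ.rowLen i → ∀ q ≤ a.length, (e i j ≤ q ↔ j < κ q i) := by
    intro i j hj q hq
    exact ⟨fun h => (he i j hj).1.trans_le (hmono _ _ h hq i), fun h => Nat.sInf_le h⟩
  have hstep : ∀ i j, j < μ.rowLen (i + 1) → e i j < e (i + 1) j := by
    intro i j hj
    obtain ⟨h1, h2, h3⟩ := he (i + 1) j hj
    obtain ⟨q, hq⟩ : ∃ q, e (i + 1) j = q + 1 := ⟨_, (Nat.sub_add_cancel h2).symm⟩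
    rw [hq] at h1 h3 ⊢
    have h4 := h1.trans_le ((hs q h3).1 i).1
    exact Nat.lt_succ_of_le
      ((hiff i j (hj.trans_le (μ.rowLen_anti _ _ (Nat.le_succ i))) q (by omega)).2 h4)
  let F : ℕ → ℕ → ℕ := fun i j => if j < μ.rowLen i then e i j else 0
  have hF : ∀ i j, j < μ.rowLen i → F i j = e i j := fun i j hj => if_pos hj
  let T : SemistandardYoungTableau μ :=
    { entry := F
      row_weak' := by
        intro i j k hjk hk
        rw [YoungDiagram.mem_iff_lt_rowLen] at hk
        rw [hF i j (hjk.trans hk), hF i k hk]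
        obtain ⟨h1, -, h3⟩ := he i k hk
        exact (hiff i j (hjk.trans hk) _ h3).2 (hjk.trans h1)
      col_strict' := by
        intro i k j hik hk
        rw [YoungDiagram.mem_iff_lt_rowLen] at hk
        induction k, hik using Nat.le_induction with
        | base =>
          rw [hF _ j hk, hF i j (hk.trans_le (μ.rowLen_anti _ _ (Nat.le_succ i)))]
          exact hstep i j hk
        | succ k hik ih =>
          have hk' := hk.trans_le (μ.rowLen_anti _ _ (Nat.le_succ k))
          refine (ih hk').trans ?_
          rw [hF _ j hk, hF k j hk']
          exact hstep k j hk
      zeros' := by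
        intro i j hij
        rw [YoungDiagram.mem_iff_lt_rowLen] at hij
        exact if_neg hij }
  have hcount : ∀ q ≤ a.length, ∀ i,
      ((Finset.range (μ.rowLen i)).filter fun j => F i j ≤ q).card = κ q i := by
    intro q hq i
    rw [show ((Finset.range (μ.rowLen i)).filter fun j => F i j ≤ q) = Finset.range (κ q i) from ?_,
      Finset.card_range]
    ext j
    rw [Finset.mem_filter, Finset.mem_range, Finset.mem_range]
    constructor
    · rintro ⟨h1, h2⟩
      rw [hF i j h1] at h2
      exact (hiff i j h1 q hq).1 h2
    · intro h
      have h1 := h.trans_le (hle q hq i)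
      refine ⟨h1, ?_⟩
      rw [hF i j h1]
      exact (hiff i j h1 q hq).2 h
  refine ⟨⟨T, ?_, ?_⟩, fun q hq => funext fun i => hcount q hq i⟩
  · rintro ⟨i, j⟩ hc
    rw [YoungDiagram.mem_cells, YoungDiagram.mem_iff_lt_rowLen] at hc
    change 1 ≤ F i j ∧ F i j ≤ a.length
    rw [hF i j hc]
    exact (he i j hc).2
  · rintro ⟨q, hq⟩
    change (μ.cells.filter fun c => F c.1 c.2 = q + 1).card = a[q]
    obtain ⟨K, hK⟩ := (hs q hq).2
    have h1 := card_filter_le_eq_psum μ F q (le_max_right K _)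
    have h2 := card_filter_le_eq_psum μ F (q + 1) (le_max_right K _)
    have h3 := card_filter_eq_add μ F q
    have h4 := hK _ (le_max_left K (μ.colLen 0))
    rw [funext fun i => hcount q (by omega) i] at h1
    rw [funext fun i => hcount (q + 1) (by omega) i] at h2
    change _ = psum (κ q) _ at h1
    change _ = psum (κ (q + 1)) _ at h2
    omega

end STab

/-! ### The process across all parts -/

section Chain

variable {μ : ℕ → ℕ} {a : List ℕ} {r : ℕ}

theorem dominates_take_succ {f : ℕ → ℕ} {q : ℕ} (hq : q < a.length) :
    Dominates f (sortedParts (a.take (q + 1))) ↔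
      Dominates f (sortedParts (a.take q ++ [a[q]])) := by
  rw [List.take_succ_eq_append_getElem hq]

theorem startRow_block (hpos : ∀ x ∈ a, 0 < x) {q : ℕ} (hq : q < a.length) :
    startRow a (a.drop (q + 1)).sum (removal μ a r (a.drop (q + 1)).sum) =
      if q + 1 = a.length then r else 0 := by
  split_ifs with h
  · have h0 : (a.drop (q + 1)).sum = 0 := by rw [h, List.drop_length, List.sum_nil]
    rw [h0, startRow, if_neg]
    · rfl
    · rintro ⟨m, -, hm, e⟩
      have h1 := sum_drop_eq hm
      have h2 := hpos _ (List.getElem_mem hm)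
      omega
  · rw [startRow, if_pos ⟨q + 1, by omega, by omega, rfl⟩]

/-- Downward induction on the number `q` of remaining parts: each greedy strip leaves a shape
dominating the parts still to come, which makes the next strip peelable. -/
theorem removal_chain (hpos : ∀ x ∈ a, 0 < x) (hanti : Antitone μ) (hv : ∃ K, μ K = 0)
    (hd : Dominates μ (sortedParts a))
    (hr : ∀ q (hq : q < a.length), q + 1 = a.length → a[q] ≤ μ r) {q : ℕ} (hq : q ≤ a.length) :
    (removal μ a r (a.drop q).sum).weight = a.take q ∧
    Antitone (removal μ a r (a.drop q).sum).shape ∧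
    (∃ K, (removal μ a r (a.drop q).sum).shape K = 0) ∧
    Dominates (removal μ a r (a.drop q).sum).shape (sortedParts (a.take q)) ∧
    ∀ hq : q < a.length,
      Peelable (removal μ a r (a.drop (q + 1)).sum).shape (psum (sortedParts (a.take q))) a[q]
        (if q + 1 = a.length then r else 0) ∧
      (removal μ a r (a.drop q).sum).shape =
        stripShape (removal μ a r (a.drop (q + 1)).sum).shape (psum (sortedParts (a.take q))) a[q]
          (if q + 1 = a.length then r else 0) a[q] ∧
      ∀ i < a[q], (candidateRows μ a r ((a.drop (q + 1)).sum + i)).Nonempty := by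
  induction hq using Nat.decreasingInduction with
  | self =>
    simp only [List.drop_length, List.sum_nil, List.take_length, lt_irrefl, IsEmpty.forall_iff,
      and_true]
    exact ⟨rfl, hanti, hv, hd⟩
  | of_succ q hq ih =>
    obtain ⟨h1, h2, h3, h4, -⟩ := ih
    have hm := hpos _ (List.getElem_mem hq)
    have h5 := (dominates_take_succ hq).1 h4
    have P : Peelable (removal μ a r (a.drop (q + 1)).sum).shape (psum (sortedParts (a.take q)))
        a[q] (if q + 1 = a.length then r else 0) := by
      refine Peelable.of_dominates h2 h3 h5 ?_
      split_ifs with h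
      · rw [show (a.drop (q + 1)).sum = 0 by rw [h, List.drop_length, List.sum_nil]]
        exact hr q hq h
      -- After a reset the search starts in the top row, which dominance makes at least as long as
      -- the current part.
      · have := (dominates_sortedParts_concat.1 h5 0).2
        simpa [psum_succ] using this
    have hb := fun i (hi : i ≤ a[q]) => removal_block hq hm (startRow_block hpos hq) h1 P hi
    obtain ⟨hb1, hb2, -⟩ := hb _ le_rfl
    rw [← sum_drop_eq hq] at hb1 hb2
    have hs := P.isHorizontalStrip
    rw [← hb1] at hs
    refine ⟨by rw [hb2, partialWeight, if_neg (lt_irrefl _)], ?_, ?_, ?_, fun _ => ⟨P, hb1, ?_⟩⟩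
    · exact antitone_nat_of_succ_le fun i => (hs.1 (i + 1)).2.trans (hs.1 i).1
    · obtain ⟨K, hK⟩ := h3
      have := (hs.1 K).2
      exact ⟨K, by omega⟩
    · rw [hb1]
      exact P.le_psum_stripShape
    · intro i hi
      exact ((hb i hi.le).2.2 hi).2.2.2

theorem candidateRows_nonempty
    (h : ∀ q (hq : q < a.length), ∀ i < a[q],
      (candidateRows μ a r ((a.drop (q + 1)).sum + i)).Nonempty) {i : ℕ} (hi : i < a.sum) :
    (candidateRows μ a r i).Nonempty := by
  suffices ∀ q ≤ a.length, ∀ i < (a.drop q).sum, (candidateRows μ a r i).Nonempty from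
    this 0 (Nat.zero_le _) i hi
  intro q hq
  induction hq using Nat.decreasingInduction with
  | self => simp
  | of_succ q hq ih =>
    intro i hi
    rcases lt_or_ge i (a.drop (q + 1)).sum with h1 | h1
    · exact ih i h1
    · rw [sum_drop_eq hq] at hi
      obtain ⟨d, rfl⟩ := Nat.exists_eq_add_of_le h1
      exact h q hq d (by omega)

end Chain

/-! ### The removal tableau and its minimality -/

section Tableau

variable {μ : YoungDiagram} {a : List ℕ} {r : ℕ}

theorem isRemovalTableau_of_rowCounts_eq
    (hne : ∀ i < a.sum, (candidateRows μ.rowLen a r i).Nonempty) (S : STab μ a)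
    (hS : ∀ q ≤ a.length, S.rowCounts q = (removal μ.rowLen a r (a.drop q).sum).shape) :
    IsRemovalTableau r S := by
  rintro i hi (_ | q) h1 h2 h3 h4
  · omega
  rw [Nat.add_sub_cancel] at h3
  have e1 := List.sum_take_add_sum_drop a q
  have e2 := List.sum_take_add_sum_drop a (q + 1)
  have h5 := removedBox_lt (hne i hi)
  have h6 := shape_succ_le_removedBox (μ := μ.rowLen) (a := a) (r := r) i
  have h7 := removal_shape_antitone (μ := μ.rowLen) (a := a) (r := r)
    (show (a.drop (q + 1)).sum ≤ i by omega) (removedBox μ.rowLen a r i).1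
  have h8 := removal_shape_antitone (μ := μ.rowLen) (a := a) (r := r)
    (show i + 1 ≤ (a.drop q).sum by omega) (removedBox μ.rowLen a r i).1
  have h9 := removal_shape_antitone (μ := μ.rowLen) (a := a) (r := r) (Nat.zero_le i)
    (removedBox μ.rowLen a r i).1
  have hj : (removedBox μ.rowLen a r i).2 < μ.rowLen (removedBox μ.rowLen a r i).1 :=
    h5.trans_le h9
  have h10 := S.entry_le_iff hj q
  have h11 := S.entry_le_iff hj (q + 1)
  rw [hS _ (by omega)] at h10 h11
  omega

/-- A surviving row would still contain its first box, yet every box of `μ` is removed at some step.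
-/
theorem shape_sum_eq_zero {n : ℕ} (hμ : μ.card = n)
    (hne : ∀ i < n, (candidateRows μ.rowLen a r i).Nonempty) :
    (removal μ.rowLen a r n).shape = fun _ => 0 := by
  funext l
  refine Nat.eq_zero_of_not_pos fun h => ?_
  have h1 := removal_shape_antitone (μ := μ.rowLen) (a := a) (r := r) (Nat.zero_le n) l
  have h2 : (l, 0) ∈ (μ.cells : Set (ℕ × ℕ)) := by
    rw [Finset.mem_coe, YoungDiagram.mem_cells, YoungDiagram.mem_iff_lt_rowLen]
    exact h.trans_le h1
  obtain ⟨i, hi, e⟩ := (bijOn_removedBox hμ hne).surjOn h2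
  have h3 := shape_succ_le_removedBox (μ := μ.rowLen) (a := a) (r := r) i
  have h4 := removal_shape_antitone (μ := μ.rowLen) (a := a) (r := r)
    (show i + 1 ≤ n from hi) l
  rw [e] at h3
  simp only at h3
  omega

namespace STab

theorem lastEntry_eq_iff (T : STab μ a) {h : ℕ} (hh : a.length = h + 1) (i : ℕ) :
    (0 < μ.rowLen i ∧ T.entry i (μ.rowLen i - 1) = a.length) ↔
      T.rowCounts h i ≠ μ.rowLen i := by
  have h1 := T.rowCounts_le_rowLen h i
  rcases Nat.eq_zero_or_pos (μ.rowLen i) with h0 | h0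
  · omega
  · have hj : μ.rowLen i - 1 < μ.rowLen i := by omega
    have h2 := T.entry_le_iff hj h
    have h3 := T.entry_bounds hj
    omega

theorem le_firstMaxRow_iff (T : STab μ a) {h : ℕ} (hh : a.length = h + 1) (hpos : 0 < a[h]) :
    r ≤ T.firstMaxRow ↔ ∀ i < r, T.rowCounts h i = μ.rowLen i := by
  -- The infimum of an empty set would be `0`; the entry `h + 1` occurs because its strip has `a[h]
  -- > 0` boxes.
  have hne : {i | 0 < μ.rowLen i ∧ T.entry i (μ.rowLen i - 1) = a.length}.Nonempty := by
    by_contra hem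
    have heq : T.rowCounts h = μ.rowLen := by
      funext i
      by_contra hi
      exact hem ⟨i, (T.lastEntry_eq_iff hh i).2 hi⟩
    obtain ⟨K, hK⟩ := (T.isHorizontalStrip (q := h) (by omega)).2
    have h1 := hK K le_rfl
    rw [← hh, T.rowCounts_length, heq] at h1
    omega
  constructor
  · intro hr i hi
    by_contra h1
    exact Nat.notMem_of_lt_sInf (hi.trans_le hr) ((T.lastEntry_eq_iff hh i).2 h1)
  · intro H
    refine le_csInf hne fun i hi => ?_
    by_contra h1
    exact (T.lastEntry_eq_iff hh i).1 hi (H i (by omega))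

/-- At the largest level where the counts differ, the level above agrees, so only two strips of a
common shape need comparing. -/
theorem le_of_rowCounts {S T : STab μ a}
    (H : ∀ p, 1 ≤ p → p < a.length → T.rowCounts (p + 1) = S.rowCounts (p + 1) →
      Dominates (T.rowCounts p) (S.rowCounts p)) : S ≤ T := by
  classical
  by_cases hTS : T = S
  · exact Or.inl hTS
  · right
    let Q : ℕ → Prop := fun p => T.rowCounts p ≠ S.rowCounts p
    have hex : ∃ p, 1 ≤ p ∧ p ≤ a.length ∧ Q p := by
      by_contra! hcon
      exact hTS (ext_rowCounts fun q h1 h2 => not_not.1 (hcon q h1 h2))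
    obtain ⟨p₀, h1, h2, h3⟩ := hex
    have hle : Nat.findGreatest Q a.length ≤ a.length := Nat.findGreatest_le _
    have hge : p₀ ≤ Nat.findGreatest Q a.length := Nat.le_findGreatest h2 h3
    have hQ : Q (Nat.findGreatest Q a.length) := Nat.findGreatest_spec h2 h3
    have hmax : ∀ q, Nat.findGreatest Q a.length < q → q ≤ a.length →
        T.rowCounts q = S.rowCounts q := fun q hq hqa =>
      not_not.1 (Nat.findGreatest_is_greatest hq hqa)
    refine ⟨Nat.findGreatest Q a.length, by omega, hle, hmax, ?_, hQ⟩
    have hlt : Nat.findGreatest Q a.length < a.length := by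
      refine lt_of_le_of_ne hle fun e => hQ ?_
      rw [e, rowCounts_length, rowCounts_length]
    exact H _ (by omega) hlt (hmax _ (Nat.lt_succ_self _) hlt)

end STab

theorem YoungDiagram.exists_rowLen_eq_zero (μ : YoungDiagram) : ∃ K, μ.rowLen K = 0 :=
  ⟨_, YoungDiagram.rowLen_eq_zero le_rfl⟩

theorem YoungDiagram.antitone_rowLen (μ : YoungDiagram) : Antitone μ.rowLen :=
  fun _ _ h => μ.rowLen_anti _ _ h

/-- The removal process started in a row of length at least `a_h` yields the least tableau among
those with no entry `h` above that row. -/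
theorem exists_isLeast_removalTableau {n h : ℕ} (hμ : μ.card = n) (hn : a.sum = n)
    (hpos : ∀ x ∈ a, 0 < x) (hd : Dominates μ.rowLen (sortedParts a)) (hh : a.length = h + 1)
    (hr : a[h] ≤ μ.rowLen r) :
    (∀ i < n, (candidateRows μ.rowLen a r i).Nonempty) ∧
      ∃ S : STab μ a, IsRemovalTableau r S ∧ IsLeast {T : STab μ a | r ≤ T.firstMaxRow} S := by
  have hchain := fun q (hq : q ≤ a.length) => removal_chain (r := r) hpos μ.antitone_rowLen
    μ.exists_rowLen_eq_zero hd
    (fun q hq e => by obtain rfl : q = h := by omega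
                      exact hr) hq
  have hstep := fun q (hq : q < a.length) => (hchain q hq.le).2.2.2.2 hq
  have hne : ∀ i < n, (candidateRows μ.rowLen a r i).Nonempty := fun i hi =>
    candidateRows_nonempty (fun q hq => (hstep q hq).2.2) (hn ▸ hi)
  obtain ⟨S, hS⟩ := STab.exists_rowCounts_eq (μ := μ) (a := a)
    (κ := fun q => (removal μ.rowLen a r (a.drop q).sum).shape)
    (by simp only [List.drop_zero, hn]; exact shape_sum_eq_zero hμ hne)
    (by simp only [List.drop_length, List.sum_nil]; rfl)
    (fun q hq => by
      rw [(hstep q hq).2.1]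
      exact (hstep q hq).1.isHorizontalStrip)
  have hlast := hpos _ (List.getElem_mem (show h < a.length by omega))
  refine ⟨hne, S, isRemovalTableau_of_rowCounts_eq (hn ▸ hne) S hS, ?_, ?_⟩
  · refine (S.le_firstMaxRow_iff hh hlast).2 fun i hi => ?_
    obtain ⟨P, e, -⟩ := hstep h (by omega)
    rw [hS h (by omega), e, P.stripShape_eq_of_lt (by rwa [if_pos hh.symm]), ← hh,
      List.drop_length, List.sum_nil]
    rfl
  · intro T hT
    have hT' := (T.le_firstMaxRow_iff hh hlast).1 hT
    refine STab.le_of_rowCounts fun p _ hp e => ?_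
    obtain ⟨P, e', -⟩ := hstep p hp
    have hs := T.isHorizontalStrip hp
    rw [e, hS _ hp] at hs
    rw [hS p hp.le, e']
    refine P.dominates_stripShape hs (T.dominates_rowCounts hp.le) fun i hi => ?_
    -- The row restriction matters only for the strip of the largest entry; below it the greedy
    -- strip starts in row `0`.
    split_ifs at hi with hph
    · obtain rfl : p = h := by omega
      rw [hT' i hi, hph, List.drop_length, List.sum_nil]
      rfl
    · omega

theorem le_maxRow_iff {h : ℕ} (hh : a.length = h + 1) (hpos : 0 < a[h])
    (h0 : a[h] ≤ μ.rowLen 0) : r ≤ maxRow μ.rowLen a ↔ a[h] ≤ μ.rowLen r := by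
  have hl : lastPart a = a[h] := by
    have := lastPart_concat (a.take h) a[h]
    rwa [← List.take_succ_eq_append_getElem, ← hh, List.take_length] at this
  have hb : BddAbove {i | 0 < μ.rowLen i ∧ lastPart a ≤ μ.rowLen i} := by
    refine ⟨μ.colLen 0, fun i hi => ?_⟩
    by_contra hlt
    have := YoungDiagram.rowLen_eq_zero (μ := μ) (i := i) (by omega)
    have := hi.1
    omega
  constructor
  · intro hr
    have hm := Nat.sSup_mem (s := {i | 0 < μ.rowLen i ∧ lastPart a ≤ μ.rowLen i})
      ⟨0, by omega, hl ▸ h0⟩ hb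
    exact hl ▸ hm.2.trans (μ.rowLen_anti _ _ hr)
  · intro hr
    exact le_csSup hb ⟨by omega, hl ▸ hr⟩

end Tableau

theorem theorem5p5 {n : ℕ} (hn : 0 < n) (μ : YoungDiagram) (hμ : μ.card = n)
    (a : Composition n) (hdom : Dominates μ.rowLen (sortedParts a.blocks)) :
    (∀ r ∈ removableRows μ.rowLen a.blocks, r ≤ maxRow μ.rowLen a.blocks →
      (∀ i < n, (candidateRows μ.rowLen a.blocks r i).Nonempty) ∧
      Set.BijOn (removedBox μ.rowLen a.blocks r) (Set.Iio n) (μ.cells : Set (ℕ × ℕ)) ∧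
      ∃ S : STab μ a.blocks, IsRemovalTableau r S ∧
        IsLeast {T : STab μ a.blocks | r ≤ T.firstMaxRow} S) ∧
    (minRow μ.rowLen a.blocks ∈ removableRows μ.rowLen a.blocks ∧
      minRow μ.rowLen a.blocks ≤ maxRow μ.rowLen a.blocks ∧
      ∃ S : STab μ a.blocks, IsRemovalTableau (minRow μ.rowLen a.blocks) S ∧
        IsLeast (Set.univ : Set (STab μ a.blocks)) S) ∧
    (∃! S : STab μ a.blocks, IsLeast (Set.univ : Set (STab μ a.blocks)) S) := by
  obtain ⟨h, hh⟩ : ∃ h, a.blocks.length = h + 1 := by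
    refine Nat.exists_eq_succ_of_ne_zero fun h0 => ?_
    have := a.blocks_sum
    rw [List.length_eq_zero_iff.1 h0, List.sum_nil] at this
    omega
  have hpos : ∀ x ∈ a.blocks, 0 < x := fun x hx => a.blocks_pos hx
  have hlast := hpos _ (List.getElem_mem (show h < a.blocks.length by omega))
  have hsplit : a.blocks = a.blocks.take h ++ [a.blocks[h]] := by
    rw [← List.take_succ_eq_append_getElem, ← hh, List.take_length]
  have hd := hdom
  rw [hsplit] at hd
  have h0 : a.blocks[h] ≤ μ.rowLen 0 := by
    simpa [psum_succ] using (dominates_sortedParts_concat.1 hd 0).2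
  have P : Peelable μ.rowLen (psum (sortedParts (a.blocks.take h))) a.blocks[h] 0 :=
    Peelable.of_dominates μ.antitone_rowLen μ.exists_rowLen_eq_zero hd h0
  obtain ⟨l, -, hl1, hl2⟩ := P.exists_row hlast
  -- The first step of the process started in row `0` searches all of `R(μ, a)`, so `l(μ, a)` is the
  -- row of the first greedy box.
  have hmin : IsLeast (removableRows μ.rowLen a.blocks) l := by
    have := isLeast_candidates P hlast le_rfl (stripSum_eq_zero le_rfl).le (Nat.zero_le _) hl1 hl2
    rw [stripShape_zero, Nat.sub_zero, ← hsplit] at this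
    simpa [removableRowsFrom] using this
  have hrow : minRow μ.rowLen a.blocks = l := hmin.csInf_eq
  have hlm : a.blocks[h] ≤ μ.rowLen l := by
    have := P.le_stripSum_add (Nat.zero_le l)
    omega
  -- The unrestricted greedy strip takes nothing above row `l`, and by optimality no tableau has its
  -- largest entry there either.
  have huniv : {T : STab μ a.blocks | l ≤ T.firstMaxRow} = Set.univ := by
    refine Set.eq_univ_of_forall fun T => (T.le_firstMaxRow_iff hh hlast).2 fun i hi => ?_
    have hs := T.isHorizontalStrip (q := h) (by omega)
    rw [← hh, T.rowCounts_length] at hs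
    have h1 := P.dominates_stripShape hs (T.dominates_rowCounts (by omega)) (by simp) l
    change psum _ _ ≤ psum _ _ at h1
    have h2 := P.psum_stripShape a.blocks[h] l
    have h3 := hs.psum_sub_mono (show i + 1 ≤ l from hi)
    have h4 := hs.psum_sub_mono (Nat.zero_le i)
    have h5 := (hs.1 i).2
    rw [psum_succ, psum_succ] at h3
    simp only [psum_zero] at h4
    omega
  have hmain := fun r (hr : a.blocks[h] ≤ μ.rowLen r) =>
    exists_isLeast_removalTableau hμ a.blocks_sum hpos hdom hh hr
  obtain ⟨-, S, hS1, hS2⟩ := hmain l hlm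
  rw [huniv] at hS2
  refine ⟨fun r _ hr => ?_, ⟨hrow ▸ hmin.1, ?_, S, hrow ▸ hS1, hS2⟩, S, hS2, fun T hT =>
    hT.unique hS2⟩
  · obtain ⟨h1, h2⟩ := hmain r ((le_maxRow_iff hh hlast h0).1 hr)
    exact ⟨h1, bijOn_removedBox hμ h1, h2⟩
  · rw [hrow]
    exact (le_maxRow_iff hh hlast h0).2 hlm
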